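/- \textbf{Theorem (Convergence of ADER--DeC).} Let $F:\mathbb{R}^I\to\mathbb{R}^I$ be Lipschitz continuous (with respect to any norm on $\mathbb{R}^I$; vectors of $M+1$ states carry the corresponding maximum norm). Let $\phi_0,\dots,\phi_M$ be the Lagrange polynomials of $M+1$ distinct nodes $\tau_0,\dots,\tau_M\in[0,1]$, and let $\xi_0,\dots,\xi_Z\in[0,1]$ and $w_0,\dots,w_Z\in\mathbb{R}$ be the nodes and weights of a quadrature rule on $[0,1]$ that is exact for polynomials of degree at most $\max(2M-1,0)$ (for example the Gauss--Legendre rule or, if $M\ge 1$, the Gauss--Lobatto rule with $M+1$ points). For a vector $a=(a^0,\dots,a^M)$ of states $a^m\in\mathbb{R}^I$ put $\phi(s)^Ta=\sum_m\phi_m(s)a^m$. Define the mass matrix and, for a time step $\Delta t$ and an initial state $u\in\mathbb{R}^I$, the right-hand side $$\mathrm{M}_{m,l}=\phi_m(1)\phi_l(1)-\sum_{z=0}^Z w_z\phi_m'(\xi_z)\phi_l(\xi_z),\qquad r(a)_m=\phi_m(0)u-\Delta t\sum_{z=0}^Z w_z\phi_m(\xi_z)F(\phi(\xi_z)^Ta).$$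 Then $\mathrm{M}$ is invertible. Let $$\mathcal L^1(a)=a-\mathrm{M}^{-1}r(u,\dots,u),\qquad \mathcal L^2(a)=a-\mathrm{M}^{-1}r(a),$$ and consider the DeC iteration $a^{(0)}=(u,\dots,u)$, $\mathcal L^1(a^{(k)})=\mathcal L^1(a^{(k-1)})-\mathcal L^2(a^{(k-1)})$ for $k\ge1$. It is well defined for all $\Delta t$ and $u$. One time step with $K\ge 0$ iterations maps $u$ to $\phi(1)^Ta^{(K)}$. There is a constant $\beta>0$, independent of $\Delta t$ and $u$, such that the following holds. (1) If $\Delta t>0$ and $\beta\Delta t<1$, then $\mathcal L^2(a^*)=0$ has exactly one solution $a^*$. Moreover, for all $\Delta t>0$ and every $a^*$ with $\mathcal L^2(a^*)=0$, one has $\|a^{(k+1)}-a^*\|\le\beta\Delta t\,\|a^{(k)}-a^*\|$ for all $k\ge 0$. (2) Let $T>0$ and let $\alpha\in C^{M+2}([0,T];\mathbb{R}^I)$ satisfy $\alpha'+F(\alpha)=0$. Then there is a constant $C$ such that, for all $t\ge0$ and $\Delta t>0$ with $t+\Delta t\le T$ and $\beta\Delta t\le\frac12$, the solution $a^*$ of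 $\mathcal L^2(a^*)=0$ for $u=\alpha(t)$ satisfies $\max_m\|a^{*,m}-\alpha(t+\tau_m\Delta t)\|\le C\Delta t^{M+1}$. (3) In the situation of (2), for every number $K\ge0$ of iterations the method has order of accuracy (at least) $p=\min(M+1,K)$. That is, there is a constant $C$ (depending on $K$, but not on $t$, $\Delta t$ or the mesh) such that: \quad (a) for all $t\ge0$ and $\Delta t>0$ with $t+\Delta t\le T$, the iteration started at $u=\alpha(t)$ satisfies $\max_m\|a^{(K),m}-\alpha(t+\tau_m\Delta t)\|\le C\Delta t^{p}$; \quad (b) for the same $t,\Delta t$ and $u=\alpha(t)$, the local error satisfies $\|\phi(1)^Ta^{(K)}-\alpha(t+\Delta t)\|\le C\Delta t^{p+1}$; \quad (c) for every mesh $0=t_0<t_1<\dots<t_N\le T$ with all steps at most $\Delta t$, the approximations $u_0=\alpha(0),u_1,\dots,u_N$ computed by the method, one time step per mesh interval, satisfy $\max_{0\le n\le N}\|u_n-\alpha(t_n)\|\le C\Delta t^{p}$. -/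

import Mathlib

open scoped Polynomial

noncomputable section

namespace ADER

variable {E : Type*} [NormedAddCommGroup E] [NormedSpace ℝ E]

/-- The Lagrange basis polynomial `φ_m` of the nodes `τ 0, …, τ M` (scaled to `[0, 1]`). -/
def basis {M : ℕ} (τ : Fin (M + 1) → ℝ) (m : Fin (M + 1)) : ℝ[X] :=
  Lagrange.basis Finset.univ τ m

/-- The reconstruction `φ(s)ᵀ a = ∑ m, φ_m(s) a^m` of a vector of coefficients, at scaled time
`s ∈ [0, 1]`. -/
def reconstruct {M : ℕ} (τ : Fin (M + 1) → ℝ) (a : Fin (M + 1) → E) (s : ℝ) : E :=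
  ∑ m, (basis τ m).eval s • a m

/-- The ADER mass matrix
`M_{m,l} = φ_m(1) φ_l(1) - ∑ z, w_z φ_m'(ξ_z) φ_l(ξ_z)`. -/
def massMatrix {M Z : ℕ} (τ : Fin (M + 1) → ℝ) (ξ w : Fin (Z + 1) → ℝ) :
    Matrix (Fin (M + 1)) (Fin (M + 1)) ℝ :=
  Matrix.of fun m l =>
    (basis τ m).eval 1 * (basis τ l).eval 1
      - ∑ z, w z * (basis τ m).derivative.eval (ξ z) * (basis τ l).eval (ξ z)

/-- The ADER right-hand side, with initial value `u` (the value at `t^n`) and time step `Δt`: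
`r(a)_m = φ_m(0) u - Δt ∑ z, w_z φ_m(ξ_z) F(φ(ξ_z)ᵀ a)`. -/
def rhs {M Z : ℕ} (τ : Fin (M + 1) → ℝ) (ξ w : Fin (Z + 1) → ℝ) (F : E → E) (Δt : ℝ) (u : E)
    (a : Fin (M + 1) → E) : Fin (M + 1) → E :=
  fun m => (basis τ m).eval 0 • u
    - Δt • ∑ z, (w z * (basis τ m).eval (ξ z)) • F (reconstruct τ a (ξ z))

/-- The action of a real matrix on a vector of states. -/
def act {M : ℕ} (A : Matrix (Fin (M + 1)) (Fin (M + 1)) ℝ) (a : Fin (M + 1) → E) :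
    Fin (M + 1) → E :=
  fun m => ∑ l, A m l • a l

/-- The low order operator `L¹(a) = a - M⁻¹ r(u)`, where `r` is evaluated at the coefficients
of the constant function `u`. -/
def L1 {M Z : ℕ} (τ : Fin (M + 1) → ℝ) (ξ w : Fin (Z + 1) → ℝ) (F : E → E) (Δt : ℝ) (u : E)
    (a : Fin (M + 1) → E) : Fin (M + 1) → E :=
  a - act (massMatrix τ ξ w)⁻¹ (rhs τ ξ w F Δt u fun _ => u)

/-- The high order operator `L²(a) = a - M⁻¹ r(a)`. -/
def L2 {M Z : ℕ} (τ : Fin (M + 1) → ℝ) (ξ w : Fin (Z + 1) → ℝ) (F : E → E) (Δt : ℝ) (u : E)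
    (a : Fin (M + 1) → E) : Fin (M + 1) → E :=
  a - act (massMatrix τ ξ w)⁻¹ (rhs τ ξ w F Δt u a)

/-- `a 0, a 1, …` are the iterates of the deferred correction algorithm for the ADER operators:
`a^(0)` is constantly `u`, and `L¹(a^(k+1)) = L¹(a^(k)) - L²(a^(k))`. -/
def IsDeCIteration {M Z : ℕ} (τ : Fin (M + 1) → ℝ) (ξ w : Fin (Z + 1) → ℝ) (F : E → E)
    (Δt : ℝ) (u : E) (a : ℕ → Fin (M + 1) → E) : Prop :=
  (a 0 = fun _ => u) ∧
    ∀ k, L1 τ ξ w F Δt u (a (k + 1)) = L1 τ ξ w F Δt u (a k) - L2 τ ξ w F Δt u (a k)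

/-- `v` is the result of one time step of length `Δt` started at `u`, with `K` iterations: the
value at the end of the time step of the reconstruction of the `K`-th iterate. -/
def IsStep {M Z : ℕ} (τ : Fin (M + 1) → ℝ) (ξ w : Fin (Z + 1) → ℝ) (F : E → E) (K : ℕ)
    (Δt : ℝ) (u v : E) : Prop :=
  ∃ a : ℕ → Fin (M + 1) → E, IsDeCIteration τ ξ w F Δt u a ∧ v = reconstruct τ (a K) 1

/-- The quadrature rule with nodes `ξ` and weights `w` integrates polynomials of degree at most
`d` exactly over `[0, 1]`. -/
def QuadratureExact {Z : ℕ} (ξ w : Fin (Z + 1) → ℝ) (d : ℕ) : Prop :=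
  ∀ p : ℝ[X], p.natDegree ≤ d → ∑ z, w z * p.eval (ξ z) = ∫ s in (0 : ℝ)..1, p.eval s

end ADER

end

noncomputable section

namespace ADER

variable {E : Type*} [NormedAddCommGroup E] [NormedSpace ℝ E]

/-! Exactness in degree `2 * M - 1` makes integration by parts exact for products of polynomials of
degree at most `M`. On nodal values of such a polynomial q, the mass matrix therefore produces
φ_m(0) q(0) + ∑ w φ_m q' (`sum_massMatrix_mul_eval`). The same exactness excludes a kernel: a left
null vector gives a polynomial q with q(1)p(1) = ∫ q'p for all admissible p, and p = (1 - X)q'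
forces q = 0.

`L1` is a translation, so the DeC iteration is the Picard iteration of a ↦ M⁻¹ r(a), which is
Lipschitz with constant β Δt. This gives the contraction and the unique fixed point. The exact nodal
values satisfy the fixed point equation up to O(h^(M+1)) (`exists_consistency`). The constant
initial guess has error O(h), and each iteration gains a power of h up to this ceiling.

The end value gains a further power. Summing the rows of M c = r(a) shows that it equals u - h ∑ w
F, evaluated at the previous iterate (`reconstruct_update`). The factor h improves the iterate's
error, and the quadrature itself errs by O(h^(M+2)). The same formula gives the stability factor 1 +
Λh, and a discrete Gronwall argument sums the local errors. -/

lemma sum_basis {M : ℕ} {τ : Fin (M + 1) → ℝ} (hτ : Function.Injective τ) :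
    ∑ m, basis τ m = 1 :=
  Lagrange.sum_basis hτ.injOn Finset.univ_nonempty

lemma natDegree_basis_le {M : ℕ} {τ : Fin (M + 1) → ℝ} (hτ : Function.Injective τ)
    (m : Fin (M + 1)) : (basis τ m).natDegree ≤ M := by
  have h := Lagrange.degree_basis (s := Finset.univ) hτ.injOn (Finset.mem_univ m)
  refine Polynomial.natDegree_le_of_degree_le ?_
  simp [basis, h]

/-- Polynomials of degree at most `M` are reproduced by interpolation. -/
lemma sum_basis_mul_eval {M : ℕ} {τ : Fin (M + 1) → ℝ} (hτ : Function.Injective τ)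
    {q : ℝ[X]} (hq : q.natDegree ≤ M) (s : ℝ) :
    ∑ l, (basis τ l).eval s * q.eval (τ l) = q.eval s := by
  have h := Lagrange.eq_interpolate (s := Finset.univ) (v := τ) (f := q) hτ.injOn (by
    refine (Polynomial.degree_le_natDegree).trans_lt ?_
    simp only [Finset.card_univ, Fintype.card_fin]
    exact_mod_cast Nat.lt_succ_of_le hq)
  conv_rhs => rw [h]
  simp [Lagrange.interpolate_apply, Polynomial.eval_finsetSum, basis, mul_comm]

/-- A constant `p` has zero derivative, so the truncated subtraction is harmless for `M = 0`;
otherwise `M ≥ 1` and differentiation lowers the degree. -/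
lemma natDegree_derivative_mul_le {M : ℕ} {p q : ℝ[X]} (hp : p.natDegree ≤ M)
    (hq : q.natDegree ≤ M) : (p.derivative * q).natDegree ≤ 2 * M - 1 := by
  rcases Nat.eq_zero_or_pos p.natDegree with h | h
  · rw [Polynomial.natDegree_eq_zero.mp h |>.choose_spec.symm]
    simp
  · have h1 := Polynomial.natDegree_mul_le (p := p.derivative) (q := q)
    have h2 := Polynomial.natDegree_derivative_lt (p := p) h.ne'
    omega

lemma integral_eval_derivative (p : ℝ[X]) :
    ∫ s in (0 : ℝ)..1, p.derivative.eval s = p.eval 1 - p.eval 0 :=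
  intervalIntegral.integral_eq_sub_of_hasDerivAt (fun s _ => p.hasDerivAt s)
    (p.derivative.continuous.intervalIntegrable _ _)

/-! ### Discrete integration by parts and invertibility of the mass matrix -/

section MassMatrix

variable {M Z : ℕ} {τ : Fin (M + 1) → ℝ} {ξ w : Fin (Z + 1) → ℝ}

/-- The mass matrix on nodal values of a polynomial, after discrete integration by parts. -/
lemma sum_massMatrix_mul_eval (hτ : Function.Injective τ)
    (hexact : QuadratureExact ξ w (2 * M - 1)) {q : ℝ[X]} (hq : q.natDegree ≤ M)
    (m : Fin (M + 1)) :
    ∑ l, massMatrix τ ξ w m l * q.eval (τ l) =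
      (basis τ m).eval 0 * q.eval 0
        + ∑ z, w z * (basis τ m).eval (ξ z) * q.derivative.eval (ξ z) := by
  -- The quadrature integrates (φ_m q)' exactly; after the product rule, the boundary term at 1
  -- cancels the one in the mass matrix.
  have hdeg : (basis τ m * q).derivative.natDegree ≤ 2 * M - 1 := by
    rw [Polynomial.derivative_mul, mul_comm (basis τ m)]
    exact Polynomial.natDegree_add_le_of_degree_le
      (natDegree_derivative_mul_le (natDegree_basis_le hτ m) hq)
      (natDegree_derivative_mul_le hq (natDegree_basis_le hτ m))
  have h := hexact _ hdeg
  rw [integral_eval_derivative] at h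
  simp only [Polynomial.derivative_mul, Polynomial.eval_add, Polynomial.eval_mul, mul_add,
    Finset.sum_add_distrib] at h
  have h1 : ∑ l, massMatrix τ ξ w m l * q.eval (τ l) =
      (basis τ m).eval 1 * q.eval 1
        - ∑ z, w z * (basis τ m).derivative.eval (ξ z) * q.eval (ξ z) := by
    simp only [massMatrix, Matrix.of_apply, sub_mul, Finset.sum_sub_distrib, Finset.sum_mul]
    rw [Finset.sum_comm]
    simp only [mul_assoc, ← Finset.mul_sum, sum_basis_mul_eval hτ hq]
  rw [h1]
  simp only [mul_assoc] at h ⊢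
  linarith

/-- Since the φ_m sum to 1, their derivatives sum to 0 and the quadrature term disappears. Summing
rows thus recovers reconstruction at the end of the step. -/
lemma sum_massMatrix_col (hτ : Function.Injective τ) (l : Fin (M + 1)) :
    ∑ m, massMatrix τ ξ w m l = (basis τ l).eval 1 := by
  have h1 (s : ℝ) : ∑ m, (basis τ m).eval s = 1 := by
    rw [← Polynomial.eval_finsetSum, sum_basis hτ, Polynomial.eval_one]
  have h2 (s : ℝ) : ∑ m, (basis τ m).derivative.eval s = 0 := by
    rw [← Polynomial.eval_finsetSum, ← Polynomial.derivative_sum, sum_basis hτ]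
    simp
  simp only [massMatrix, Matrix.of_apply, Finset.sum_sub_distrib, ← Finset.sum_mul, h1, one_mul]
  rw [Finset.sum_comm]
  simp [← Finset.sum_mul, ← Finset.mul_sum, h2]

lemma isUnit_det_massMatrix (hτ : Function.Injective τ)
    (hexact : QuadratureExact ξ w (2 * M - 1)) : IsUnit (massMatrix τ ξ w).det := by
  rw [isUnit_iff_ne_zero]
  intro hdet
  obtain ⟨d, hd0, hd⟩ := Matrix.exists_vecMul_eq_zero_iff.mpr hdet
  apply hd0
  set q : ℝ[X] := ∑ m, Polynomial.C (d m) * basis τ m with hq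
  have hqdeg : q.natDegree ≤ M := Polynomial.natDegree_sum_le_of_forall_le _ _ fun m _ =>
    (Polynomial.natDegree_C_mul_le _ _).trans (natDegree_basis_le hτ m)
  have hrow (l : Fin (M + 1)) :
      q.eval 1 * (basis τ l).eval 1 - ∑ z, w z * q.derivative.eval (ξ z) * (basis τ l).eval (ξ z)
        = 0 := by
    refine Eq.trans ?_ (congrFun hd l)
    simp only [Matrix.vecMul, dotProduct, massMatrix, Matrix.of_apply, hq, mul_sub,
      Finset.sum_sub_distrib, Polynomial.eval_finsetSum, Polynomial.derivative_sum,
      Polynomial.derivative_C_mul, Polynomial.eval_mul, Polynomial.eval_C, Finset.sum_mul,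
      Finset.mul_sum]
    rw [Finset.sum_comm (s := Finset.univ (α := Fin (Z + 1)))]
    congr 1
    · exact Finset.sum_congr rfl fun _ _ => by ring
    · exact Finset.sum_congr rfl fun _ _ => Finset.sum_congr rfl fun _ _ => by ring
  -- Weighting the null relations by the nodal values of `p` replaces the basis by an arbitrary test
  -- polynomial; exactness replaces the quadrature by the integral.
  have htest {p : ℝ[X]} (hp : p.natDegree ≤ M) :
      q.eval 1 * p.eval 1 = ∫ s in (0 : ℝ)..1, (q.derivative * p).eval s := by
    rw [← hexact _ (natDegree_derivative_mul_le hqdeg hp)]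
    have h : ∑ l, (q.eval 1 * (basis τ l).eval 1
        - ∑ z, w z * q.derivative.eval (ξ z) * (basis τ l).eval (ξ z)) * p.eval (τ l) = 0 :=
      Finset.sum_eq_zero fun l _ => by rw [hrow, zero_mul]
    simp only [sub_mul, Finset.sum_sub_distrib, Finset.sum_mul] at h
    rw [Finset.sum_comm] at h
    simp only [mul_assoc, ← Finset.mul_sum, sum_basis_mul_eval hτ hp] at h
    simp only [Polynomial.eval_mul]
    linarith
  have hder : q.derivative = 0 := by
    by_contra hne
    have hpos : 0 < q.natDegree := by
      rw [Nat.pos_iff_ne_zero]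
      intro h0
      exact hne (Polynomial.derivative_of_natDegree_zero h0)
    -- This test polynomial vanishes at 1 and leaves ∫ (1 - s) q'(s)² = 0, whose integrand is
    -- nonnegative. The degree lost in q' pays for the factor 1 - X.
    have hdeg : ((1 - Polynomial.X) * q.derivative).natDegree ≤ M := by
      have h1 := Polynomial.natDegree_mul_le (p := 1 - Polynomial.X) (q := q.derivative)
      have h2 := Polynomial.natDegree_derivative_lt hpos.ne'
      have h3 : (1 - Polynomial.X : ℝ[X]).natDegree ≤ 1 := by compute_degree
      omega
    have hint := htest hdeg
    simp only [Polynomial.eval_mul, Polynomial.eval_sub, Polynomial.eval_one, Polynomial.eval_X,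
      sub_self, zero_mul, mul_zero] at hint
    apply hne
    refine Polynomial.eq_of_infinite_eval_eq _ _
      ((Set.Ico_infinite (zero_lt_one (α := ℝ))).mono fun s hs => ?_)
    by_contra hs0
    simp only [Set.mem_ofPred_eq, Polynomial.eval_zero] at hs0
    refine (intervalIntegral.integral_pos zero_lt_one ?_ ?_ ⟨s, ⟨hs.1, hs.2.le⟩, ?_⟩).ne hint
    · fun_prop
    · intro x hx
      have := hx.2
      nlinarith [mul_nonneg (sub_nonneg.2 hx.2) (mul_self_nonneg (q.derivative.eval x))]
    · have := mul_pos (sub_pos.2 hs.2) (mul_self_pos.2 hs0)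
      linarith
  have hq1 : q.eval 1 = 0 := by
    have h := htest (p := 1) (by simp)
    simpa [hder] using h
  have hq0 : q = 0 := by
    have hC := Polynomial.eq_C_of_derivative_eq_zero hder
    rw [hC, Polynomial.eval_C] at hq1
    rw [hC, hq1, Polynomial.C_0]
  funext m
  have h : q.eval (τ m) = d m := by
    rw [hq, Polynomial.eval_finsetSum, Finset.sum_eq_single m]
    · simp [basis, Lagrange.eval_basis_self hτ.injOn]
    · intro l _ hl
      simp [basis, Lagrange.eval_basis_of_ne hl]
    · simp
  rw [← h, hq0]
  simp

end MassMatrix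

/-! ### The fixed point map and its Lipschitz bounds -/

section Operators

variable {M Z : ℕ} {τ : Fin (M + 1) → ℝ} {ξ w : Fin (Z + 1) → ℝ}

lemma act_sub (A : Matrix (Fin (M + 1)) (Fin (M + 1)) ℝ) (a b : Fin (M + 1) → E) :
    act A (a - b) = act A a - act A b := by
  funext m
  simp [act, smul_sub]

lemma act_act (A B : Matrix (Fin (M + 1)) (Fin (M + 1)) ℝ) (a : Fin (M + 1) → E) :
    act A (act B a) = act (A * B) a := by
  funext m
  simp only [act, Matrix.mul_apply, Finset.smul_sum, Finset.sum_smul, smul_smul]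
  exact Finset.sum_comm

lemma act_one (a : Fin (M + 1) → E) : act 1 a = a := by
  funext m
  simp [act, Matrix.one_apply, ite_smul]

lemma exists_norm_act_le (A : Matrix (Fin (M + 1)) (Fin (M + 1)) ℝ) :
    ∃ κ : ℝ, 0 ≤ κ ∧ ∀ a : Fin (M + 1) → E, ‖act A a‖ ≤ κ * ‖a‖ := by
  refine ⟨∑ m, ∑ l, |A m l|, by positivity, fun a => ?_⟩
  refine (pi_norm_le_iff_of_nonneg (by positivity)).2 fun m => ?_
  calc ‖act A a m‖ ≤ ∑ l, |A m l| * ‖a‖ := norm_sum_le_of_le _ fun l _ => by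
        rw [norm_smul, Real.norm_eq_abs]
        gcongr
        exact norm_le_pi_norm a l
    _ = (∑ l, |A m l|) * ‖a‖ := (Finset.sum_mul _ _ _).symm
    _ ≤ _ := mul_le_mul_of_nonneg_right (Finset.single_le_sum (f := fun m => ∑ l, |A m l|)
          (fun _ _ => by positivity) (Finset.mem_univ m)) (norm_nonneg _)

lemma reconstruct_sub (a b : Fin (M + 1) → E) (s : ℝ) :
    reconstruct τ (a - b) s = reconstruct τ a s - reconstruct τ b s := by
  simp [reconstruct, smul_sub]

lemma reconstruct_const (hτ : Function.Injective τ) (u : E) (s : ℝ) :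
    reconstruct τ (fun _ => u) s = u := by
  rw [reconstruct, ← Finset.sum_smul, ← Polynomial.eval_finsetSum, sum_basis hτ]
  simp

lemma exists_norm_reconstruct_le (τ : Fin (M + 1) → ℝ) (ξ : Fin (Z + 1) → ℝ) :
    ∃ κ : ℝ, 0 ≤ κ ∧ ∀ (a : Fin (M + 1) → E) (z : Fin (Z + 1)),
      ‖reconstruct τ a (ξ z)‖ ≤ κ * ‖a‖ := by
  refine ⟨∑ z, ∑ l, |(basis τ l).eval (ξ z)|, by positivity, fun a z => ?_⟩
  calc ‖reconstruct τ a (ξ z)‖ ≤ ∑ l, |(basis τ l).eval (ξ z)| * ‖a‖ :=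
        norm_sum_le_of_le _ fun l _ => by
          rw [norm_smul, Real.norm_eq_abs]
          gcongr
          exact norm_le_pi_norm a l
    _ = (∑ l, |(basis τ l).eval (ξ z)|) * ‖a‖ := (Finset.sum_mul _ _ _).symm
    _ ≤ _ := by
        gcongr
        exact Finset.single_le_sum (f := fun z => ∑ l, |(basis τ l).eval (ξ z)|)
          (fun _ _ => by positivity) (Finset.mem_univ z)

/-- The fixed point map `a ↦ M⁻¹ r(a)`. -/
def update {M Z : ℕ} (τ : Fin (M + 1) → ℝ) (ξ w : Fin (Z + 1) → ℝ) (F : E → E) (Δt : ℝ) (u : E)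
    (a : Fin (M + 1) → E) : Fin (M + 1) → E :=
  act (massMatrix τ ξ w)⁻¹ (rhs τ ξ w F Δt u a)

variable {F : E → E} {Δt : ℝ} {u : E}

lemma L2_eq_zero_iff {b : Fin (M + 1) → E} :
    L2 τ ξ w F Δt u b = 0 ↔ b = update τ ξ w F Δt u b :=
  sub_eq_zero

/-- `L1` subtracts a vector independent of its argument, which cancels from both sides and leaves a
Picard iteration. -/
lemma isDeCIteration_iff {a : ℕ → Fin (M + 1) → E} :
    IsDeCIteration τ ξ w F Δt u a ↔
      (a 0 = fun _ => u) ∧ ∀ k, a (k + 1) = update τ ξ w F Δt u (a k) := by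
  unfold IsDeCIteration
  refine and_congr_right fun _ => forall_congr' fun k => ?_
  rw [L1, L1, L2, sub_sub_sub_cancel_left, sub_eq_sub_iff_add_eq_add, update]
  constructor
  · intro h
    simpa using h
  · intro h
    rw [h]

lemma existsUnique_isDeCIteration (τ : Fin (M + 1) → ℝ) (ξ w : Fin (Z + 1) → ℝ) (F : E → E)
    (Δt : ℝ) (u : E) : ∃! a : ℕ → Fin (M + 1) → E, IsDeCIteration τ ξ w F Δt u a := by
  refine ⟨fun k => (update τ ξ w F Δt u)^[k] fun _ => u,
    isDeCIteration_iff.2 ⟨rfl, fun k => Function.iterate_succ_apply' _ _ _⟩, fun a ha => ?_⟩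
  obtain ⟨h0, hs⟩ := isDeCIteration_iff.1 ha
  funext k
  induction k with
  | zero => exact h0
  | succ k ih => rw [hs, ih, Function.iterate_succ_apply']

lemma act_massMatrix_update (hdet : IsUnit (massMatrix τ ξ w).det) (a : Fin (M + 1) → E) :
    act (massMatrix τ ξ w) (update τ ξ w F Δt u a) = rhs τ ξ w F Δt u a := by
  rw [update, act_act, Matrix.mul_nonsing_inv _ hdet, act_one]

/-- The value of the update at the end of the time step is a quadrature of the right-hand
side. -/
lemma reconstruct_update (hτ : Function.Injective τ) (hdet : IsUnit (massMatrix τ ξ w).det)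
    (a : Fin (M + 1) → E) :
    reconstruct τ (update τ ξ w F Δt u a) 1 =
      u - Δt • ∑ z, w z • F (reconstruct τ a (ξ z)) := by
  have h1 (s : ℝ) : ∑ m, (basis τ m).eval s = 1 := by
    rw [← Polynomial.eval_finsetSum, sum_basis hτ, Polynomial.eval_one]
  -- Summing the rows of M c = r(a) gives the end value on the left; on the right, the basis
  -- functions sum to 1.
  have h := congrArg (fun b : Fin (M + 1) → E => ∑ m, b m)
    (act_massMatrix_update (F := F) (Δt := Δt) (u := u) hdet a)
  simp only [act, rhs] at h
  rw [Finset.sum_comm, Finset.sum_sub_distrib] at h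
  simp only [← Finset.sum_smul, ← Finset.smul_sum, sum_massMatrix_col hτ, h1, one_smul] at h
  rw [reconstruct, h, Finset.sum_comm]
  simp only [← Finset.sum_smul, ← Finset.mul_sum, h1, mul_one]

/-- The right-hand side, and hence the fixed point map, is Lipschitz in the coefficients with
constant proportional to the time step, and Lipschitz in the initial value. -/
lemma exists_norm_update_sub_le (τ : Fin (M + 1) → ℝ) (ξ w : Fin (Z + 1) → ℝ) {L : NNReal}
    (hF : LipschitzWith L F) :
    ∃ β κ : ℝ, 0 < β ∧ 0 ≤ κ ∧ ∀ (Δt : ℝ) (u v : E) (a b : Fin (M + 1) → E), 0 ≤ Δt →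
      ‖update τ ξ w F Δt u a - update τ ξ w F Δt v b‖ ≤ κ * ‖u - v‖ + β * Δt * ‖a - b‖ := by
  obtain ⟨κ, hκ, hA⟩ := exists_norm_act_le (E := E) (massMatrix τ ξ w)⁻¹
  obtain ⟨ρ, hρ, hR⟩ := exists_norm_reconstruct_le (E := E) τ ξ
  set γ : ℝ := ∑ m, ∑ z, |w z * (basis τ m).eval (ξ z)| with hγ
  set η : ℝ := ∑ m, |(basis τ m).eval 0| with hη
  have hγ0 : 0 ≤ γ := by positivity
  have hη0 : 0 ≤ η := by positivity
  -- The factors bound M⁻¹, the weighted quadrature, `F` and the reconstruction. The added 1 only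
  -- makes β positive.
  refine ⟨κ * (γ * (L * ρ)) + 1, κ * η, by positivity, by positivity,
    fun Δt u v a b ht => ?_⟩
  have hr : ‖rhs τ ξ w F Δt u a - rhs τ ξ w F Δt v b‖ ≤
      η * ‖u - v‖ + Δt * (γ * (L * ρ * ‖a - b‖)) := by
    refine (pi_norm_le_iff_of_nonneg (by positivity)).2 fun m => ?_
    have he : (rhs τ ξ w F Δt u a - rhs τ ξ w F Δt v b) m = (basis τ m).eval 0 • (u - v)
        - Δt • ∑ z, (w z * (basis τ m).eval (ξ z)) •
          (F (reconstruct τ a (ξ z)) - F (reconstruct τ b (ξ z))) := by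
      simp only [Pi.sub_apply, rhs, smul_sub, Finset.sum_sub_distrib]
      abel
    rw [he]
    refine (norm_sub_le _ _).trans (add_le_add ?_ ?_)
    · rw [norm_smul, Real.norm_eq_abs]
      gcongr
      exact Finset.single_le_sum (f := fun m => |(basis τ m).eval 0|) (fun _ _ => by positivity)
        (Finset.mem_univ m)
    · rw [norm_smul, Real.norm_of_nonneg ht]
      gcongr
      calc _ ≤ ∑ z, |w z * (basis τ m).eval (ξ z)| * (L * ρ * ‖a - b‖) :=
            norm_sum_le_of_le _ fun z _ => by
              rw [norm_smul, Real.norm_eq_abs]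
              gcongr
              refine (hF.norm_sub_le _ _).trans ?_
              rw [← reconstruct_sub, mul_assoc]
              gcongr
              exact hR _ z
        _ = (∑ z, |w z * (basis τ m).eval (ξ z)|) * (L * ρ * ‖a - b‖) :=
            (Finset.sum_mul _ _ _).symm
        _ ≤ _ := by
            gcongr
            exact Finset.single_le_sum (f := fun m => ∑ z, |w z * (basis τ m).eval (ξ z)|)
              (fun _ _ => by positivity) (Finset.mem_univ m)
  rw [update, update, ← act_sub]
  refine (hA _).trans ((mul_le_mul_of_nonneg_left hr hκ).trans ?_)
  have : 0 ≤ Δt * ‖a - b‖ := by positivity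
  nlinarith

/-- Banach's fixed point theorem; completeness of `E` is needed only here. -/
lemma existsUnique_eq_update [CompleteSpace E] {β : ℝ} (h1 : β * Δt < 1)
    (hβ : 0 ≤ β * Δt)
    (hup : ∀ a b : Fin (M + 1) → E,
      ‖update τ ξ w F Δt u a - update τ ξ w F Δt u b‖ ≤ β * Δt * ‖a - b‖) :
    ∃! b : Fin (M + 1) → E, L2 τ ξ w F Δt u b = 0 := by
  have hc : ContractingWith ⟨β * Δt, hβ⟩ (update τ ξ w F Δt u) :=
    ⟨by exact_mod_cast h1, LipschitzWith.of_dist_le_mul fun a b => by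
      rw [dist_eq_norm, dist_eq_norm]
      exact hup a b⟩
  refine ⟨ContractingWith.fixedPoint _ hc, L2_eq_zero_iff.2 hc.fixedPoint_isFixedPt.symm,
    fun b hb => hc.fixedPoint_unique (L2_eq_zero_iff.1 hb).symm⟩

end Operators

/-! ### Uniform local polynomial approximation -/

/-- Integration of a local polynomial approximation of the derivative. -/
lemma exists_polynomial_approx_of_derivative {f g : ℝ → E} {T C : ℝ} {n : ℕ}
    (hfg : ∀ t ∈ Set.Icc 0 T, HasDerivWithinAt f (g t) (Set.Icc 0 T) t)
    {t h : ℝ} (ht : 0 ≤ t) (hh : 0 < h) (hth : t + h ≤ T) {d : ℕ → E}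
    (hd : ∀ s ∈ Set.Icc (0 : ℝ) 1,
      ‖g (t + s * h) - ∑ j ∈ Finset.range n, s ^ j • d j‖ ≤ C * h ^ n) :
    ∃ c : ℕ → E,
      (∀ s ∈ Set.Icc (0 : ℝ) 1,
        ‖f (t + s * h) - ∑ j ∈ Finset.range (n + 1), s ^ j • c j‖ ≤ C * h ^ (n + 1)) ∧
      ∀ s ∈ Set.Icc (0 : ℝ) 1,
        ‖h • g (t + s * h) - ∑ j ∈ Finset.range (n + 1), (j * s ^ (j - 1)) • c j‖
          ≤ C * h ^ (n + 1) := by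
  -- The termwise antiderivative in the scaled time s, with value `f t` at s = 0; the chain rule
  -- supplies `h`.
  set c : ℕ → E := fun j => if j = 0 then f t else (h / j) • d (j - 1) with hc
  have hder (s : ℝ) : ∑ j ∈ Finset.range (n + 1), (j * s ^ (j - 1)) • c j =
      h • ∑ j ∈ Finset.range n, s ^ j • d j := by
    rw [Finset.sum_range_succ', Finset.smul_sum]
    simp only [Nat.cast_zero, zero_mul, zero_smul, add_zero]
    refine Finset.sum_congr rfl fun j _ => ?_
    simp only [hc, Nat.add_eq_zero_iff, one_ne_zero, and_false, if_false, Nat.add_sub_cancel,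
      smul_smul]
    congr 1
    field_simp
  have hmem {s : ℝ} (hs : s ∈ Set.Icc (0 : ℝ) 1) : t + s * h ∈ Set.Icc 0 T :=
    ⟨by nlinarith [mul_nonneg hs.1 hh.le], by nlinarith [mul_nonneg (sub_nonneg.2 hs.2) hh.le]⟩
  have hbound : ∀ s ∈ Set.Icc (0 : ℝ) 1,
      ‖h • g (t + s * h) - ∑ j ∈ Finset.range (n + 1), (j * s ^ (j - 1)) • c j‖
        ≤ C * h ^ (n + 1) := fun s hs => by
    rw [hder, ← smul_sub, norm_smul, Real.norm_of_nonneg hh.le, pow_succ]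
    nlinarith [mul_le_mul_of_nonneg_left (hd s hs) hh.le]
  refine ⟨c, fun s hs => ?_, hbound⟩
  have hD : ∀ s ∈ Set.Icc (0 : ℝ) 1, HasDerivWithinAt
      (fun s => f (t + s * h) - ∑ j ∈ Finset.range (n + 1), s ^ j • c j)
      (h • g (t + s * h) - ∑ j ∈ Finset.range (n + 1), (j * s ^ (j - 1)) • c j)
      (Set.Icc 0 1) s := fun s hs => by
    refine HasDerivWithinAt.sub ?_ ?_
    · refine (hfg _ (hmem hs)).scomp s (h := fun s => t + s * h) ?_ fun x hx => hmem hx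
      simpa using ((hasDerivAt_id s).mul_const h).const_add t |>.hasDerivWithinAt
    · exact HasDerivWithinAt.fun_sum fun j _ => ((hasDerivAt_pow j s).smul_const (c j)).hasDerivWithinAt
  have h0 : f (t + 0 * h) - ∑ j ∈ Finset.range (n + 1), (0 : ℝ) ^ j • c j = 0 := by
    rw [Finset.sum_range_succ']
    simp [hc]
  -- The error vanishes at s = 0, so the mean value inequality turns the derivative bound into the
  -- same bound for the error.
  have hmv := (convex_Icc (0 : ℝ) 1).norm_image_sub_le_of_norm_hasDerivWithin_le hD hbound
    (Set.left_mem_Icc.2 zero_le_one) hs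
  rw [h0, sub_zero, sub_zero, Real.norm_of_nonneg hs.1] at hmv
  have hC : 0 ≤ C * h ^ (n + 1) := (norm_nonneg _).trans (hbound s hs)
  exact hmv.trans (by nlinarith [hs.2])

/-- A `C^n` function is locally approximated to order `n` by polynomials of degree less than
`n`, uniformly. -/
lemma exists_uniform_polynomial_approx {T : ℝ} (hT : 0 < T) (n : ℕ) {f : ℝ → E}
    (hf : ContDiffOn ℝ n f (Set.Icc 0 T)) :
    ∃ C : ℝ, 0 ≤ C ∧ ∀ t h : ℝ, 0 ≤ t → 0 < h → t + h ≤ T → ∃ c : ℕ → E,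
      ∀ s ∈ Set.Icc (0 : ℝ) 1,
        ‖f (t + s * h) - ∑ j ∈ Finset.range n, s ^ j • c j‖ ≤ C * h ^ n := by
  -- Approximate the derivative, then integrate. The constant is unchanged throughout and is a bound
  -- for the `n`-th derivative.
  induction n generalizing f with
  | zero =>
    obtain ⟨C, hC⟩ := isCompact_Icc.exists_bound_of_continuousOn hf.continuousOn
    refine ⟨C, (norm_nonneg _).trans (hC 0 ⟨le_rfl, hT.le⟩), fun t h ht hh hth =>
      ⟨0, fun s hs => ?_⟩⟩
    simpa using hC (t + s * h)
      ⟨by nlinarith [mul_nonneg hs.1 hh.le], by nlinarith [mul_nonneg (sub_nonneg.2 hs.2) hh.le]⟩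
  | succ n ih =>
    have hu := uniqueDiffOn_Icc hT
    have hf' : ContDiffOn ℝ n (derivWithin f (Set.Icc 0 T)) (Set.Icc 0 T) :=
      hf.derivWithin hu (by norm_cast)
    obtain ⟨C, hC, hap⟩ := ih hf'
    refine ⟨C, hC, fun t h ht hh hth => ?_⟩
    obtain ⟨d, hd⟩ := hap t h ht hh hth
    obtain ⟨c, hc, -⟩ := exists_polynomial_approx_of_derivative
      (fun t ht => (hf.differentiableOn (by norm_cast) t ht).hasDerivWithinAt) ht hh hth hd
    exact ⟨c, hc⟩

/-- Simultaneous approximation of a function and its derivative. -/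
lemma exists_polynomial_approx_with_derivative {T : ℝ} (hT : 0 < T) (n : ℕ) {f g : ℝ → E}
    (hfg : ∀ t ∈ Set.Icc 0 T, HasDerivWithinAt f (g t) (Set.Icc 0 T) t)
    (hf : ContDiffOn ℝ ((n + 1 : ℕ) : WithTop ℕ∞) f (Set.Icc 0 T)) :
    ∃ C : ℝ, 0 ≤ C ∧ ∀ t h : ℝ, 0 ≤ t → 0 < h → t + h ≤ T → ∃ c : ℕ → E,
      (∀ s ∈ Set.Icc (0 : ℝ) 1,
        ‖f (t + s * h) - ∑ j ∈ Finset.range (n + 1), s ^ j • c j‖ ≤ C * h ^ (n + 1)) ∧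
      ∀ s ∈ Set.Icc (0 : ℝ) 1,
        ‖h • g (t + s * h) - ∑ j ∈ Finset.range (n + 1), (j * s ^ (j - 1)) • c j‖
          ≤ C * h ^ (n + 1) := by
  have hu := uniqueDiffOn_Icc hT
  have hg : ContDiffOn ℝ n g (Set.Icc 0 T) :=
    (hf.derivWithin hu (m := n) (by norm_cast)).congr fun t ht =>
      ((hfg t ht).derivWithin (hu t ht)).symm
  obtain ⟨C, hC, hap⟩ := exists_uniform_polynomial_approx hT n hg
  refine ⟨C, hC, fun t h ht hh hth => ?_⟩
  obtain ⟨d, hd⟩ := hap t h ht hh hth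
  exact exists_polynomial_approx_of_derivative hfg ht hh hth hd

/-! ### Consistency with the exact solution -/

section Consistency

variable {M Z : ℕ} {τ : Fin (M + 1) → ℝ} {ξ w : Fin (Z + 1) → ℝ}

/-- Coefficient sequences represent `E`-valued polynomials, so scalar identities transfer monomial
by monomial. -/
lemma reconstruct_sum_pow (hτ : Function.Injective τ) (c : ℕ → E) (s : ℝ) :
    reconstruct τ (fun m => ∑ j ∈ Finset.range (M + 1), τ m ^ j • c j) s =
      ∑ j ∈ Finset.range (M + 1), s ^ j • c j := by
  simp only [reconstruct, Finset.smul_sum, smul_smul]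
  rw [Finset.sum_comm]
  refine Finset.sum_congr rfl fun j hj => ?_
  have h := sum_basis_mul_eval hτ (q := Polynomial.X ^ j)
    (by simpa using Nat.lt_succ_iff.1 (Finset.mem_range.1 hj)) s
  simp only [Polynomial.eval_pow, Polynomial.eval_X] at h
  rw [← Finset.sum_smul, h]

lemma act_massMatrix_sum_pow (hτ : Function.Injective τ)
    (hexact : QuadratureExact ξ w (2 * M - 1)) (c : ℕ → E) (m : Fin (M + 1)) :
    act (massMatrix τ ξ w) (fun m => ∑ j ∈ Finset.range (M + 1), τ m ^ j • c j) m =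
      (basis τ m).eval 0 • (∑ j ∈ Finset.range (M + 1), (0 : ℝ) ^ j • c j)
        + ∑ z, (w z * (basis τ m).eval (ξ z)) •
          ∑ j ∈ Finset.range (M + 1), (j * ξ z ^ (j - 1)) • c j := by
  simp only [act, Finset.smul_sum, smul_smul]
  rw [Finset.sum_comm, Finset.sum_comm (s := Finset.univ (α := Fin (Z + 1))),
    ← Finset.sum_add_distrib]
  refine Finset.sum_congr rfl fun j hj => ?_
  have h := sum_massMatrix_mul_eval hτ hexact (q := Polynomial.X ^ j)
    (by simpa using Nat.lt_succ_iff.1 (Finset.mem_range.1 hj)) m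
  simp only [Polynomial.eval_pow, Polynomial.eval_X, Polynomial.derivative_X_pow,
    Polynomial.eval_mul, Polynomial.eval_C] at h
  rw [← Finset.sum_smul, ← Finset.sum_smul, h, add_smul]

/-- The polynomial may have degree `M + 1`, one more than interpolation reproduces: its derivative
has degree at most `M`, which exactness covers (constants if `M = 0`). This is the source of the
extra order at the end of a step. -/
lemma sum_weight_smul_derivative (hexact : QuadratureExact ξ w (2 * M - 1)) (c : ℕ → E) :
    ∑ z, w z • ∑ j ∈ Finset.range (M + 1 + 1), (j * ξ z ^ (j - 1)) • c j =
      ∑ j ∈ Finset.range (M + 1 + 1), (1 : ℝ) ^ j • c j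
        - ∑ j ∈ Finset.range (M + 1 + 1), (0 : ℝ) ^ j • c j := by
  simp only [Finset.smul_sum, smul_smul]
  rw [Finset.sum_comm, ← Finset.sum_sub_distrib]
  refine Finset.sum_congr rfl fun j hj => ?_
  have hdeg : (Polynomial.X ^ j : ℝ[X]).derivative.natDegree ≤ 2 * M - 1 := by
    have h1 := Polynomial.natDegree_derivative_le (Polynomial.X ^ j : ℝ[X])
    rw [Polynomial.natDegree_X_pow] at h1
    have h2 := Finset.mem_range.1 hj
    omega
  have h := hexact _ hdeg
  rw [integral_eval_derivative] at h
  simp only [Polynomial.eval_pow, Polynomial.eval_X, Polynomial.derivative_X_pow,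
    Polynomial.eval_mul, Polynomial.eval_C] at h
  rw [← Finset.sum_smul, h, sub_smul]

variable {F : E → E} {L : NNReal} {T : ℝ} {α : ℝ → E}

/-- The exact nodal values nearly solve the fixed point equation, and their interpolant is close
to the exact solution at the quadrature nodes. -/
lemma exists_consistency (hτ : Function.Injective τ) (hτI : ∀ m, τ m ∈ Set.Icc (0 : ℝ) 1)
    (hξI : ∀ z, ξ z ∈ Set.Icc (0 : ℝ) 1) (hexact : QuadratureExact ξ w (2 * M - 1))
    (hF : LipschitzWith L F) (hT : 0 < T)
    (hα : ∀ t ∈ Set.Icc 0 T, HasDerivWithinAt α (-F (α t)) (Set.Icc 0 T) t)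
    (hreg : ContDiffOn ℝ ((M + 1 : ℕ) : WithTop ℕ∞) α (Set.Icc 0 T)) :
    ∃ C : ℝ, 0 ≤ C ∧ ∀ t h : ℝ, 0 ≤ t → 0 < h → t + h ≤ T →
      ‖update τ ξ w F h (α t) (fun m => α (t + τ m * h)) - fun m => α (t + τ m * h)‖
        ≤ C * h ^ (M + 1) ∧
      ∀ z, ‖reconstruct τ (fun m => α (t + τ m * h)) (ξ z) - α (t + ξ z * h)‖
        ≤ C * h ^ (M + 1) := by
  obtain ⟨C, hC, hap⟩ := exists_polynomial_approx_with_derivative hT M hα hreg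
  obtain ⟨κ, hκ, hA⟩ := exists_norm_act_le (E := E) (massMatrix τ ξ w)⁻¹
  obtain ⟨μ, hμ, hB⟩ := exists_norm_act_le (E := E) (massMatrix τ ξ w)
  obtain ⟨ρ, hρ, hR⟩ := exists_norm_reconstruct_le (E := E) τ ξ
  have hdet := isUnit_det_massMatrix hτ hexact
  set γ : ℝ := ∑ m, ∑ z, |w z * (basis τ m).eval (ξ z)| with hγ
  set η : ℝ := ∑ m, |(basis τ m).eval 0| with hη
  have hγ0 : 0 ≤ γ := by positivity
  have hη0 : 0 ≤ η := by positivity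
  set C₁ : ℝ := (ρ + 1) * C with hC₁
  have hC₁0 : 0 ≤ C₁ := by positivity
  set C₂ : ℝ := κ * (μ * C + (η * C + γ * (C + T * (L * C₁)))) with hC₂
  have hC₂0 : 0 ≤ C₂ := by positivity
  refine ⟨C₁ + C₂, by positivity, fun t h ht hh hth => ?_⟩
  obtain ⟨c, hc, hc'⟩ := hap t h ht hh hth
  have hhT : h ≤ T := by linarith
  have hp : 0 ≤ h ^ (M + 1) := by positivity
  set a : Fin (M + 1) → E := fun m => α (t + τ m * h) with ha
  set b : Fin (M + 1) → E := fun m => ∑ j ∈ Finset.range (M + 1), τ m ^ j • c j with hb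
  have hab : ‖a - b‖ ≤ C * h ^ (M + 1) :=
    (pi_norm_le_iff_of_nonneg (by positivity)).2 fun m => hc _ (hτI m)
  have hrec (z : Fin (Z + 1)) :
      ‖reconstruct τ a (ξ z) - α (t + ξ z * h)‖ ≤ C₁ * h ^ (M + 1) := by
    have he : reconstruct τ a (ξ z) - α (t + ξ z * h) = reconstruct τ (a - b) (ξ z)
        - (α (t + ξ z * h) - ∑ j ∈ Finset.range (M + 1), ξ z ^ j • c j) := by
      rw [reconstruct_sub, hb, reconstruct_sum_pow hτ]
      abel
    rw [he]
    refine (norm_sub_le _ _).trans ((add_le_add (hR _ z) (hc _ (hξI z))).trans ?_)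
    rw [hC₁]
    nlinarith [mul_le_mul_of_nonneg_left hab hρ]
  refine ⟨?_, fun z => (hrec z).trans (by gcongr; linarith)⟩
  have hres : ‖act (massMatrix τ ξ w) b - rhs τ ξ w F h (α t) a‖ ≤
      (η * C + γ * (C + T * (L * C₁))) * h ^ (M + 1) := by
    refine (pi_norm_le_iff_of_nonneg (by positivity)).2 fun m => ?_
    -- With α' = -F(α), the residual splits into the polynomial's error at 0, the interpolation
    -- error seen through `F`, and its derivative error. The spare factor `h` in the second is
    -- bounded by `T`.
    have he : (act (massMatrix τ ξ w) b - rhs τ ξ w F h (α t) a) m =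
        -((basis τ m).eval 0 •
          (α (t + 0 * h) - ∑ j ∈ Finset.range (M + 1), (0 : ℝ) ^ j • c j))
        + ∑ z, (w z * (basis τ m).eval (ξ z)) •
          (h • (F (reconstruct τ a (ξ z)) - F (α (t + ξ z * h)))
            - (h • (-F (α (t + ξ z * h)))
              - ∑ j ∈ Finset.range (M + 1), (j * ξ z ^ (j - 1)) • c j)) := by
      rw [Pi.sub_apply, hb, act_massMatrix_sum_pow hτ hexact, rhs, zero_mul,
        add_zero]
      have h1 : ∑ z, (w z * (basis τ m).eval (ξ z)) •
          (h • (F (reconstruct τ a (ξ z)) - F (α (t + ξ z * h)))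
            - (h • (-F (α (t + ξ z * h)))
              - ∑ j ∈ Finset.range (M + 1), (j * ξ z ^ (j - 1)) • c j)) =
          h • ∑ z, (w z * (basis τ m).eval (ξ z)) • F (reconstruct τ a (ξ z))
          + ∑ z, (w z * (basis τ m).eval (ξ z)) •
            ∑ j ∈ Finset.range (M + 1), (j * ξ z ^ (j - 1)) • c j := by
        rw [Finset.smul_sum, ← Finset.sum_add_distrib]
        refine Finset.sum_congr rfl fun z _ => ?_
        module
      rw [h1]
      module
    rw [he, add_mul]
    refine (norm_add_le _ _).trans (add_le_add ?_ ?_)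
    · rw [norm_neg, norm_smul, Real.norm_eq_abs, mul_assoc]
      refine mul_le_mul ?_ (hc 0 ⟨le_rfl, zero_le_one⟩) (norm_nonneg _) hη0
      exact Finset.single_le_sum (f := fun m => |(basis τ m).eval 0|) (fun _ _ => by positivity)
        (Finset.mem_univ m)
    · calc _ ≤ ∑ z, |w z * (basis τ m).eval (ξ z)| * ((C + T * (L * C₁)) * h ^ (M + 1)) :=
            norm_sum_le_of_le _ fun z _ => by
              rw [norm_smul, Real.norm_eq_abs]
              gcongr
              calc _ ≤ T * (L * (C₁ * h ^ (M + 1))) + C * h ^ (M + 1) := by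
                    refine (norm_sub_le _ _).trans (add_le_add ?_ (hc' _ (hξI z)))
                    rw [norm_smul, Real.norm_of_nonneg hh.le]
                    exact mul_le_mul hhT ((hF.norm_sub_le _ _).trans
                      (mul_le_mul_of_nonneg_left (hrec z) L.2)) (norm_nonneg _) hT.le
                _ = _ := by ring
        _ = (∑ z, |w z * (basis τ m).eval (ξ z)|) * ((C + T * (L * C₁)) * h ^ (M + 1)) :=
            (Finset.sum_mul _ _ _).symm
        _ ≤ γ * ((C + T * (L * C₁)) * h ^ (M + 1)) := by
            refine mul_le_mul_of_nonneg_right ?_ (by positivity)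
            exact Finset.single_le_sum (f := fun m => ∑ z, |w z * (basis τ m).eval (ξ z)|)
              (fun _ _ => by positivity) (Finset.mem_univ m)
        _ = _ := by ring
  have he : update τ ξ w F h (α t) a - a = -act (massMatrix τ ξ w)⁻¹
      (act (massMatrix τ ξ w) (a - b)
        - (rhs τ ξ w F h (α t) a - act (massMatrix τ ξ w) b)) := by
    rw [act_sub, act_sub, act_sub, act_sub, act_act, act_act, Matrix.nonsing_inv_mul _ hdet,
      act_one, act_one, update]
    abel
  rw [he, norm_neg]
  refine (hA _).trans ?_
  calc κ * _ ≤ κ * (μ * (C * h ^ (M + 1)) + (η * C + γ * (C + T * (L * C₁))) * h ^ (M + 1)) := by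
        gcongr
        refine (norm_sub_le _ _).trans (add_le_add ((hB _).trans (by gcongr)) ?_)
        rw [norm_sub_rev]
        exact hres
    _ = C₂ * h ^ (M + 1) := by rw [hC₂]; ring
    _ ≤ _ := by gcongr; linarith

/-- The quadrature error for the integral form of the differential equation. -/
lemma exists_quadrature_error_le (hξI : ∀ z, ξ z ∈ Set.Icc (0 : ℝ) 1)
    (hexact : QuadratureExact ξ w (2 * M - 1)) (hT : 0 < T)
    (hα : ∀ t ∈ Set.Icc 0 T, HasDerivWithinAt α (-F (α t)) (Set.Icc 0 T) t)
    (hreg : ContDiffOn ℝ ((M + 2 : ℕ) : WithTop ℕ∞) α (Set.Icc 0 T)) :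
    ∃ C : ℝ, 0 ≤ C ∧ ∀ t h : ℝ, 0 ≤ t → 0 < h → t + h ≤ T →
      ‖α t - h • ∑ z, w z • F (α (t + ξ z * h)) - α (t + h)‖ ≤ C * h ^ (M + 2) := by
  -- Degree `M + 1` rather than `M`: this is where the smoothness C^(M+2) is used.
  obtain ⟨C, hC, hap⟩ := exists_polynomial_approx_with_derivative hT (M + 1) hα hreg
  refine ⟨C + C + (∑ z, |w z|) * C, by positivity, fun t h ht hh hth => ?_⟩
  obtain ⟨c, hc, hc'⟩ := hap t h ht hh hth
  have h0 := hc 0 ⟨le_rfl, zero_le_one⟩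
  have h1 := hc 1 ⟨zero_le_one, le_rfl⟩
  have hs : ‖∑ z, w z • (h • (-F (α (t + ξ z * h)))
      - ∑ j ∈ Finset.range (M + 1 + 1), (j * ξ z ^ (j - 1)) • c j)‖
        ≤ (∑ z, |w z|) * (C * h ^ (M + 2)) := by
    rw [Finset.sum_mul]
    refine norm_sum_le_of_le _ fun z _ => ?_
    rw [norm_smul, Real.norm_eq_abs]
    exact mul_le_mul_of_nonneg_left (hc' _ (hξI z)) (abs_nonneg _)
  have he : α t - h • ∑ z, w z • F (α (t + ξ z * h)) - α (t + h) =
      (α (t + 0 * h) - ∑ j ∈ Finset.range (M + 1 + 1), (0 : ℝ) ^ j • c j)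
      - (α (t + 1 * h) - ∑ j ∈ Finset.range (M + 1 + 1), (1 : ℝ) ^ j • c j)
      + ∑ z, w z • (h • (-F (α (t + ξ z * h)))
        - ∑ j ∈ Finset.range (M + 1 + 1), (j * ξ z ^ (j - 1)) • c j) := by
    have h2 : ∑ z, w z • (h • (-F (α (t + ξ z * h)))
        - ∑ j ∈ Finset.range (M + 1 + 1), (j * ξ z ^ (j - 1)) • c j) =
        -(h • ∑ z, w z • F (α (t + ξ z * h))) -
          ∑ z, w z • ∑ j ∈ Finset.range (M + 1 + 1), (j * ξ z ^ (j - 1)) • c j := by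
      rw [Finset.smul_sum, ← Finset.sum_neg_distrib, ← Finset.sum_sub_distrib]
      refine Finset.sum_congr rfl fun z _ => ?_
      module
    rw [h2, sum_weight_smul_derivative hexact, zero_mul, add_zero, one_mul]
    abel
  rw [he]
  refine (norm_add_le _ _).trans ((add_le_add ((norm_sub_le _ _).trans (add_le_add h0 h1))
    hs).trans (le_of_eq ?_))
  ring

end Consistency

/-- Surplus powers of `h` become a constant; the base `1 + T` is at least 1, so its powers increase
with the exponent. -/
lemma pow_le_mul_pow_of_le {h T : ℝ} (hh : 0 ≤ h) (hT : h ≤ T) {i j : ℕ} (hij : i ≤ j) :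
    h ^ j ≤ (1 + T) ^ j * h ^ i := by
  obtain ⟨k, rfl⟩ := Nat.exists_eq_add_of_le hij
  rw [pow_add, mul_comm]
  gcongr
  calc h ^ k ≤ (1 + T) ^ k := by gcongr; linarith
    _ ≤ (1 + T) ^ (i + k) := pow_le_pow_right₀ (by linarith) (by omega)

/-! ### Local error, stability and global error -/

section Accuracy

variable {M Z : ℕ} {τ : Fin (M + 1) → ℝ} {ξ w : Fin (Z + 1) → ℝ} {F : E → E} {L : NNReal}
  {T : ℝ} {α : ℝ → E}

/-- The `k`-th iterate is accurate of order `min (M + 1) (k + 1)` at the nodes. -/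
lemma exists_iterate_error_le (hτ : Function.Injective τ) (hτI : ∀ m, τ m ∈ Set.Icc (0 : ℝ) 1)
    (hξI : ∀ z, ξ z ∈ Set.Icc (0 : ℝ) 1) (hexact : QuadratureExact ξ w (2 * M - 1))
    (hF : LipschitzWith L F) (hT : 0 < T)
    (hα : ∀ t ∈ Set.Icc 0 T, HasDerivWithinAt α (-F (α t)) (Set.Icc 0 T) t)
    (hreg : ContDiffOn ℝ ((M + 1 : ℕ) : WithTop ℕ∞) α (Set.Icc 0 T)) (k : ℕ) :
    ∃ C : ℝ, 0 ≤ C ∧ ∀ (t h : ℝ) (a : ℕ → Fin (M + 1) → E), 0 ≤ t → 0 < h → t + h ≤ T →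
      IsDeCIteration τ ξ w F h (α t) a →
      ‖a k - fun m => α (t + τ m * h)‖ ≤ C * h ^ min (M + 1) (k + 1) := by
  obtain ⟨β, κ, hβ, hκ, hup⟩ := exists_norm_update_sub_le τ ξ w hF
  obtain ⟨C, hC, hcons⟩ := exists_consistency hτ hτI hξI hexact hF hT hα hreg
  induction k with
  | zero =>
    -- The initial value and each exact nodal value lie within O(h) of the same constant.
    obtain ⟨C, hC, hap⟩ := exists_uniform_polynomial_approx hT 1
      (hreg.of_le (by exact_mod_cast (by omega : 1 ≤ M + 1)))
    refine ⟨C + C, by positivity, fun t h a ht hh hth ha => ?_⟩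
    obtain ⟨c, hc⟩ := hap t h ht hh hth
    rw [ha.1, zero_add, Nat.min_eq_right (by omega)]
    refine (pi_norm_le_iff_of_nonneg (by positivity)).2 fun m => ?_
    have h0 := hc 0 ⟨le_rfl, zero_le_one⟩
    have h1 := hc _ (hτI m)
    simp only [Finset.range_one, Finset.sum_singleton, pow_zero, one_smul, zero_mul,
      add_zero] at h0 h1
    rw [Pi.sub_apply, ← sub_sub_sub_cancel_right (α t) _ (c 0), add_mul]
    exact (norm_sub_le _ _).trans (add_le_add h0 h1)
  | succ k ih =>
    obtain ⟨D, hD, hit⟩ := ih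
    refine ⟨(β * D + C) * (1 + T) ^ (M + 2), by positivity, fun t h a ht hh hth ha => ?_⟩
    have hhT : h ≤ T := by linarith
    have h1 : h * h ^ min (M + 1) (k + 1) ≤ (1 + T) ^ (M + 2) * h ^ min (M + 1) (k + 1 + 1) := by
      rw [← pow_succ']
      refine (pow_le_mul_pow_of_le hh.le hhT (i := min (M + 1) (k + 1 + 1)) (by omega)).trans ?_
      exact mul_le_mul_of_nonneg_right (pow_le_pow_right₀ (by linarith) (by omega)) (by positivity)
    have h2 : h ^ (M + 1) ≤ (1 + T) ^ (M + 2) * h ^ min (M + 1) (k + 1 + 1) := by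
      refine (pow_le_mul_pow_of_le hh.le hhT (i := min (M + 1) (k + 1 + 1)) (by omega)).trans ?_
      exact mul_le_mul_of_nonneg_right (pow_le_pow_right₀ (by linarith) (by omega)) (by positivity)
    have h3 := hup h (α t) (α t) (a k) (fun m => α (t + τ m * h)) hh.le
    rw [sub_self, norm_zero, mul_zero, zero_add] at h3
    -- Inserting the update of the exact nodal values separates the contraction of the previous
    -- error from the consistency error.
    rw [(isDeCIteration_iff.1 ha).2,
      ← sub_add_sub_cancel _ (update τ ξ w F h (α t) fun m => α (t + τ m * h))]
    calc _ ≤ β * h * (D * h ^ min (M + 1) (k + 1)) + C * h ^ (M + 1) :=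
          (norm_add_le _ _).trans (add_le_add
            (h3.trans (mul_le_mul_of_nonneg_left (hit t h a ht hh hth ha) (by positivity)))
            (hcons t h ht hh hth).1)
      _ = β * D * (h * h ^ min (M + 1) (k + 1)) + C * h ^ (M + 1) := by ring
      _ ≤ β * D * ((1 + T) ^ (M + 2) * h ^ min (M + 1) (k + 1 + 1))
          + C * ((1 + T) ^ (M + 2) * h ^ min (M + 1) (k + 1 + 1)) := by gcongr
      _ = _ := by ring

lemma isStep_zero_iff (hτ : Function.Injective τ) {h : ℝ} {u v : E} :
    IsStep τ ξ w F 0 h u v ↔ v = u := by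
  constructor
  · rintro ⟨a, ha, rfl⟩
    rw [ha.1, reconstruct_const hτ]
  · rintro rfl
    obtain ⟨a, ha, -⟩ := existsUnique_isDeCIteration τ ξ w F h v
    exact ⟨a, ha, by rw [ha.1, reconstruct_const hτ]⟩

lemma IsDeCIteration.reconstruct_succ (hτ : Function.Injective τ)
    (hexact : QuadratureExact ξ w (2 * M - 1)) {h : ℝ} {u : E} {a : ℕ → Fin (M + 1) → E}
    (ha : IsDeCIteration τ ξ w F h u a) (k : ℕ) :
    reconstruct τ (a (k + 1)) 1 = u - h • ∑ z, w z • F (reconstruct τ (a k) (ξ z)) := by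
  rw [(isDeCIteration_iff.1 ha).2, reconstruct_update hτ (isUnit_det_massMatrix hτ hexact)]

lemma norm_sum_weight_smul_sub_le (hF : LipschitzWith L F) {x y : Fin (Z + 1) → E} {B : ℝ}
    (hxy : ∀ z, ‖x z - y z‖ ≤ B) :
    ‖∑ z, w z • F (x z) - ∑ z, w z • F (y z)‖ ≤ (∑ z, |w z|) * (L * B) := by
  rw [← Finset.sum_sub_distrib, Finset.sum_mul]
  refine norm_sum_le_of_le _ fun z _ => ?_
  rw [← smul_sub, norm_smul, Real.norm_eq_abs]
  exact mul_le_mul_of_nonneg_left ((hF.norm_sub_le _ _).trans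
    (mul_le_mul_of_nonneg_left (hxy z) L.2)) (abs_nonneg _)

/-- The local error of one time step. -/
lemma exists_local_error_le (hτ : Function.Injective τ) (hτI : ∀ m, τ m ∈ Set.Icc (0 : ℝ) 1)
    (hξI : ∀ z, ξ z ∈ Set.Icc (0 : ℝ) 1) (hexact : QuadratureExact ξ w (2 * M - 1))
    (hF : LipschitzWith L F) (hT : 0 < T)
    (hα : ∀ t ∈ Set.Icc 0 T, HasDerivWithinAt α (-F (α t)) (Set.Icc 0 T) t)
    (hreg : ContDiffOn ℝ ((M + 2 : ℕ) : WithTop ℕ∞) α (Set.Icc 0 T)) (K : ℕ) :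
    ∃ C : ℝ, 0 ≤ C ∧ ∀ (t h : ℝ) (v : E), 0 ≤ t → 0 < h → t + h ≤ T →
      IsStep τ ξ w F K h (α t) v →
      ‖v - α (t + h)‖ ≤ C * h ^ (min (M + 1) K + 1) := by
  have hreg' : ContDiffOn ℝ ((M + 1 : ℕ) : WithTop ℕ∞) α (Set.Icc 0 T) :=
    hreg.of_le (by norm_cast; omega)
  cases K with
  | zero =>
    obtain ⟨C, hC, hap⟩ := exists_uniform_polynomial_approx hT 1
      (hreg.of_le (by exact_mod_cast (by omega : 1 ≤ M + 2)))
    refine ⟨C + C, by positivity, fun t h v ht hh hth hv => ?_⟩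
    obtain ⟨c, hc⟩ := hap t h ht hh hth
    have h0 := hc 0 ⟨le_rfl, zero_le_one⟩
    have h1 := hc 1 ⟨zero_le_one, le_rfl⟩
    simp only [Finset.range_one, Finset.sum_singleton, pow_zero, one_smul, zero_mul, one_mul,
      add_zero] at h0 h1
    rw [(isStep_zero_iff hτ).1 hv, Nat.min_zero, zero_add,
      ← sub_sub_sub_cancel_right (α t) _ (c 0), add_mul]
    exact (norm_sub_le _ _).trans (add_le_add h0 h1)
  | succ k =>
    -- Index `k` suffices for `k + 1` iterations: the end value sees iterate `k` only through `F`,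
    -- multiplied by `h`.
    obtain ⟨C₁, hC₁, hit⟩ := exists_iterate_error_le hτ hτI hξI hexact hF hT hα hreg' k
    obtain ⟨C₂, hC₂, hcons⟩ := exists_consistency hτ hτI hξI hexact hF hT hα hreg'
    obtain ⟨C₃, hC₃, hquad⟩ := exists_quadrature_error_le hξI hexact hT hα hreg
    obtain ⟨ρ, hρ, hR⟩ := exists_norm_reconstruct_le (E := E) τ ξ
    set p := min (M + 1) (k + 1) with hp
    set S : ℝ := (1 + T) ^ (M + 1) with hS
    have hS0 : 0 ≤ S := by positivity
    refine ⟨(∑ z, |w z|) * (L * (ρ * C₁ + C₂ * S)) + C₃ * S, by positivity,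
      fun t h v ht hh hth hv => ?_⟩
    obtain ⟨a, ha, rfl⟩ := hv
    have hpow : h ^ (M + 1) ≤ S * h ^ p :=
      pow_le_mul_pow_of_le hh.le (by linarith) (Nat.min_le_left _ _)
    have hx (z : Fin (Z + 1)) :
        ‖reconstruct τ (a k) (ξ z) - α (t + ξ z * h)‖ ≤ (ρ * C₁ + C₂ * S) * h ^ p := by
      rw [← sub_add_sub_cancel _ (reconstruct τ (fun m => α (t + τ m * h)) (ξ z)),
        ← reconstruct_sub]
      calc _ ≤ ρ * (C₁ * h ^ p) + C₂ * (S * h ^ p) :=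
            (norm_add_le _ _).trans (add_le_add
              ((hR _ z).trans (mul_le_mul_of_nonneg_left (hit t h a ht hh hth ha) hρ))
              (((hcons t h ht hh hth).2 z).trans (mul_le_mul_of_nonneg_left hpow hC₂)))
        _ = _ := by ring
    have hsum := norm_sum_weight_smul_sub_le (w := w) hF hx
    rw [ha.reconstruct_succ hτ hexact]
    have he : α t - h • ∑ z, w z • F (reconstruct τ (a k) (ξ z)) - α (t + h) =
        (α t - h • ∑ z, w z • F (α (t + ξ z * h)) - α (t + h))
        - h • (∑ z, w z • F (reconstruct τ (a k) (ξ z)) - ∑ z, w z • F (α (t + ξ z * h))) := by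
      module
    rw [he]
    calc _ ≤ C₃ * (h * (S * h ^ p))
          + h * ((∑ z, |w z|) * (L * ((ρ * C₁ + C₂ * S) * h ^ p))) := by
          refine (norm_sub_le _ _).trans (add_le_add ((hquad t h ht hh hth).trans ?_) ?_)
          · rw [pow_succ']
            gcongr
          · rw [norm_smul, Real.norm_of_nonneg hh.le]
            gcongr
      _ = _ := by ring

/-- One time step is Lipschitz in the initial value, with constant `1 + O(h)`. -/
lemma exists_step_stability (hτ : Function.Injective τ)
    (hexact : QuadratureExact ξ w (2 * M - 1)) (hF : LipschitzWith L F) (hT : 0 < T) (K : ℕ) :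
    ∃ Λ : ℝ, 0 ≤ Λ ∧ ∀ (h : ℝ) (u u' v v' : E), 0 < h → h ≤ T →
      IsStep τ ξ w F K h u v → IsStep τ ξ w F K h u' v' →
      ‖v - v'‖ ≤ (1 + Λ * h) * ‖u - u'‖ := by
  obtain ⟨β, κ, hβ, hκ, hup⟩ := exists_norm_update_sub_le τ ξ w hF
  -- A crude bound is enough here: `D` enters the end value only with a factor `h`, and the leading
  -- 1 comes from the explicit term `u`.
  have hit (k : ℕ) : ∃ D : ℝ, 0 ≤ D ∧ ∀ (h : ℝ) (u u' : E) (a a' : ℕ → Fin (M + 1) → E),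
      0 < h → h ≤ T → IsDeCIteration τ ξ w F h u a → IsDeCIteration τ ξ w F h u' a' →
      ‖a k - a' k‖ ≤ D * ‖u - u'‖ := by
    induction k with
    | zero =>
      refine ⟨1, zero_le_one, fun h u u' a a' _ _ ha ha' => ?_⟩
      rw [ha.1, ha'.1, one_mul]
      exact (pi_norm_le_iff_of_nonneg (norm_nonneg _)).2 fun _ => le_rfl
    | succ k ih =>
      obtain ⟨D, hD, ih⟩ := ih
      refine ⟨κ + β * T * D, by positivity, fun h u u' a a' hh hhT ha ha' => ?_⟩
      rw [(isDeCIteration_iff.1 ha).2, (isDeCIteration_iff.1 ha').2]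
      refine (hup h u u' _ _ hh.le).trans ?_
      rw [add_mul, mul_assoc (β * T)]
      gcongr
      exact ih h u u' a a' hh hhT ha ha'
  cases K with
  | zero =>
    refine ⟨0, le_rfl, fun h u u' v v' _ _ hv hv' => ?_⟩
    rw [(isStep_zero_iff hτ).1 hv, (isStep_zero_iff hτ).1 hv', zero_mul, add_zero, one_mul]
  | succ k =>
    obtain ⟨D, hD, hit⟩ := hit k
    obtain ⟨ρ, hρ, hR⟩ := exists_norm_reconstruct_le (E := E) τ ξ
    refine ⟨(∑ z, |w z|) * (L * (ρ * D)), by positivity, fun h u u' v v' hh hhT hv hv' => ?_⟩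
    obtain ⟨a, ha, rfl⟩ := hv
    obtain ⟨a', ha', rfl⟩ := hv'
    have hx (z : Fin (Z + 1)) : ‖reconstruct τ (a k) (ξ z) - reconstruct τ (a' k) (ξ z)‖
        ≤ ρ * (D * ‖u - u'‖) := by
      rw [← reconstruct_sub]
      exact (hR _ z).trans (mul_le_mul_of_nonneg_left (hit h u u' a a' hh hhT ha ha') hρ)
    have hsum := norm_sum_weight_smul_sub_le (w := w) hF hx
    rw [ha.reconstruct_succ hτ hexact, ha'.reconstruct_succ hτ hexact, sub_sub_sub_comm,
      ← smul_sub]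
    calc _ ≤ ‖u - u'‖ + h * ((∑ z, |w z|) * (L * (ρ * (D * ‖u - u'‖)))) := by
          refine (norm_sub_le _ _).trans (add_le_add le_rfl ?_)
          rw [norm_smul, Real.norm_of_nonneg hh.le]
          gcongr
      _ = _ := by ring

lemma mesh_mono {t : ℕ → ℝ} {N : ℕ} (ht : ∀ n < N, t n < t (n + 1)) {m n : ℕ} (hmn : m ≤ n)
    (hn : n ≤ N) : t m ≤ t n := by
  induction n, hmn using Nat.le_induction with
  | base => exact le_rfl
  | succ n _ ih => exact (ih (by omega)).trans (ht n (by omega)).le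

/-- Stability and local accuracy of order `p + 1` give global accuracy of order `p`. -/
lemma norm_sub_le_of_local_error {V : Type*} [NormedAddCommGroup V] {α : ℝ → V}
    {S : ℝ → V → V → Prop} {T Λ C Δt : ℝ} {p N : ℕ} (hΛ : 0 ≤ Λ)
    (hC : 0 ≤ C)
    (hstab : ∀ (h : ℝ) (u u' v v' : V), 0 < h → h ≤ T → S h u v → S h u' v' →
      ‖v - v'‖ ≤ (1 + Λ * h) * ‖u - u'‖)
    (hex : ∀ (h : ℝ) (u : V), ∃ v, S h u v)
    (hloc : ∀ (t h : ℝ) (v : V), 0 ≤ t → 0 < h → t + h ≤ T → S h (α t) v →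
      ‖v - α (t + h)‖ ≤ C * h ^ (p + 1))
    {t : ℕ → ℝ} {u : ℕ → V} (ht0 : t 0 = 0) (htN : t N ≤ T)
    (hmesh : ∀ n < N, t n < t (n + 1) ∧ t (n + 1) - t n ≤ Δt) (hu0 : u 0 = α 0)
    (hu : ∀ n < N, S (t (n + 1) - t n) (u n) (u (n + 1))) :
    ∀ n ≤ N, ‖u n - α (t n)‖ ≤ Real.exp (Λ * t n) * (C * Δt ^ p) * t n := by
  have hmono {m n : ℕ} (hmn : m ≤ n) (hn : n ≤ N) : t m ≤ t n :=
    mesh_mono (fun n hn => (hmesh n hn).1) hmn hn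
  intro n
  induction n with
  | zero => simp [ht0, hu0]
  | succ n ih =>
    intro hn
    have ih := ih (by omega)
    obtain ⟨hlt, hle⟩ := hmesh n (by omega)
    have htn : 0 ≤ t n := ht0 ▸ hmono (Nat.zero_le n) (by omega)
    have htT : t (n + 1) ≤ T := (hmono hn le_rfl).trans htN
    -- One step from the exact value separates the propagated error from the new local error.
    obtain ⟨v, hv⟩ := hex (t (n + 1) - t n) (α (t n))
    set h := t (n + 1) - t n with hh
    have hh0 : 0 < h := sub_pos.2 hlt
    have hadd : t (n + 1) = t n + h := by rw [hh]; ring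
    have h1 := hstab h _ _ _ _ hh0 (by linarith) (hu n (by omega)) hv
    have h2 := hloc (t n) h v htn hh0 (by linarith) hv
    have h3 : C * h ^ (p + 1) ≤ Real.exp (Λ * t (n + 1)) * (C * Δt ^ p) * h := by
      have h4 : C * h ^ (p + 1) ≤ C * Δt ^ p * h := by
        rw [pow_succ, ← mul_assoc]
        gcongr
      have h5 : 0 ≤ C * Δt ^ p * h := (by positivity : 0 ≤ C * h ^ (p + 1)).trans h4
      have h6 : 1 ≤ Real.exp (Λ * t (n + 1)) := Real.one_le_exp (by nlinarith)
      nlinarith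
    -- Since 1 + Λh ≤ exp(Λh), the exponential absorbs the amplification, while the factor `t n`
    -- accumulates the step lengths.
    have h7 : (1 + Λ * h) * Real.exp (Λ * t n) ≤ Real.exp (Λ * t (n + 1)) := by
      rw [hadd, mul_add, add_comm (Λ * t n), Real.exp_add]
      gcongr
      linarith [Real.add_one_le_exp (Λ * h)]
    have hΔ : 0 ≤ Δt := hh0.le.trans hle
    rw [← sub_add_sub_cancel _ v]
    calc _ ≤ (1 + Λ * h) * (Real.exp (Λ * t n) * (C * Δt ^ p) * t n)
          + Real.exp (Λ * t (n + 1)) * (C * Δt ^ p) * h := by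
          refine (norm_add_le _ _).trans (add_le_add (h1.trans ?_) ?_)
          · gcongr
          · rw [hadd] at h3 ⊢
            exact h2.trans h3
      _ = (1 + Λ * h) * Real.exp (Λ * t n) * (C * Δt ^ p * t n)
          + Real.exp (Λ * t (n + 1)) * (C * Δt ^ p) * h := by ring
      _ ≤ Real.exp (Λ * t (n + 1)) * (C * Δt ^ p * t n)
          + Real.exp (Λ * t (n + 1)) * (C * Δt ^ p) * h := by gcongr
      _ = Real.exp (Λ * t (n + 1)) * (C * Δt ^ p) * (t n + h) := by ring
      _ = _ := by rw [← hadd]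

end Accuracy

end ADER

end

/-! ### The convergence theorem -/

theorem theorem1 {E : Type*} [NormedAddCommGroup E] [NormedSpace ℝ E] [FiniteDimensional ℝ E]
    (M Z : ℕ)
    -- interpolation nodes, quadrature nodes and weights, all scaled to the unit interval
    (τ : Fin (M + 1) → ℝ) (hτ : Function.Injective τ) (hτI : ∀ m, τ m ∈ Set.Icc (0 : ℝ) 1)
    (ξ w : Fin (Z + 1) → ℝ) (hξI : ∀ z, ξ z ∈ Set.Icc (0 : ℝ) 1)
    -- for `M = 0` the degree of exactness `2 * M - 1` is read as `0`
    (hexact : ADER.QuadratureExact ξ w (2 * M - 1))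
    (F : E → E) (L : NNReal) (hF : LipschitzWith L F) :
    -- the mass matrix is invertible, and the algorithm is well defined
    IsUnit (ADER.massMatrix τ ξ w).det ∧
    (∀ (Δt : ℝ) (u : E), ∃! a : ℕ → Fin (M + 1) → E, ADER.IsDeCIteration τ ξ w F Δt u a) ∧
    ∃ β : ℝ, 0 < β ∧
      -- existence and uniqueness of the solution of `L² = 0`
      (∀ (Δt : ℝ) (u : E), 0 < Δt → β * Δt < 1 →
        ∃! b : Fin (M + 1) → E, ADER.L2 τ ξ w F Δt u b = 0) ∧
      -- each iteration contracts the error by the factor `β Δt`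
      (∀ (Δt : ℝ) (u : E) (a : ℕ → Fin (M + 1) → E) (b : Fin (M + 1) → E), 0 < Δt →
        ADER.IsDeCIteration τ ξ w F Δt u a → ADER.L2 τ ξ w F Δt u b = 0 →
        ∀ k, ‖a (k + 1) - b‖ ≤ β * Δt * ‖a k - b‖) ∧
      -- accuracy with respect to an exact solution `α` of `α' + F(α) = 0` on `[0, T]`
      ∀ (T : ℝ) (α : ℝ → E), 0 < T →
        (∀ t ∈ Set.Icc 0 T, HasDerivWithinAt α (-F (α t)) (Set.Icc 0 T) t) →
        ContDiffOn ℝ ((M + 2 : ℕ) : WithTop ℕ∞) α (Set.Icc 0 T) →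
        -- the solution of `L² = 0` is accurate of order `M + 1`
        (∃ C : ℝ, ∀ (t Δt : ℝ) (b : Fin (M + 1) → E), 0 ≤ t → 0 < Δt → t + Δt ≤ T →
          β * Δt ≤ 1 / 2 → ADER.L2 τ ξ w F Δt (α t) b = 0 →
          ‖b - fun m => α (t + τ m * Δt)‖ ≤ C * Δt ^ (M + 1)) ∧
        ∀ K : ℕ, ∃ C : ℝ,
          -- the `K`-th iterate approximates the exact values at the nodes
          (∀ (t Δt : ℝ) (a : ℕ → Fin (M + 1) → E), 0 ≤ t → 0 < Δt → t + Δt ≤ T →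
            ADER.IsDeCIteration τ ξ w F Δt (α t) a →
            ‖a K - fun m => α (t + τ m * Δt)‖ ≤ C * Δt ^ min (M + 1) K) ∧
          -- local error of one time step
          (∀ (t Δt : ℝ) (v : E), 0 ≤ t → 0 < Δt → t + Δt ≤ T →
            ADER.IsStep τ ξ w F K Δt (α t) v →
            ‖v - α (t + Δt)‖ ≤ C * Δt ^ (min (M + 1) K + 1)) ∧
          -- global error on a mesh of `[0, T]` with steps of length at most `Δt`
          (∀ (N : ℕ) (t : ℕ → ℝ) (u : ℕ → E) (Δt : ℝ), 0 < Δt → t 0 = 0 → t N ≤ T →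
            (∀ n < N, t n < t (n + 1) ∧ t (n + 1) - t n ≤ Δt) →
            u 0 = α 0 →
            (∀ n < N, ADER.IsStep τ ξ w F K (t (n + 1) - t n) (u n) (u (n + 1))) →
            ∀ n ≤ N, ‖u n - α (t n)‖ ≤ C * Δt ^ min (M + 1) K) := by
  have : CompleteSpace E := FiniteDimensional.complete ℝ E
  obtain ⟨β, κ, hβ, -, hup⟩ := ADER.exists_norm_update_sub_le τ ξ w hF
  have hup' (Δt : ℝ) (u : E) (a b : Fin (M + 1) → E) (h : 0 < Δt) :
      ‖ADER.update τ ξ w F Δt u a - ADER.update τ ξ w F Δt u b‖ ≤ β * Δt * ‖a - b‖ := by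
    simpa using hup Δt u u a b h.le
  refine ⟨ADER.isUnit_det_massMatrix hτ hexact, ADER.existsUnique_isDeCIteration τ ξ w F, β, hβ,
    fun Δt u hΔt h1 => ADER.existsUnique_eq_update h1 (by positivity) fun a b =>
      hup' Δt u a b hΔt, fun Δt u a b hΔt ha hb k => ?_, fun T α hT hα hreg => ⟨?_, fun K => ?_⟩⟩
  · rw [ADER.L2_eq_zero_iff] at hb
    rw [(ADER.isDeCIteration_iff.1 ha).2]
    conv_lhs => rw [hb]
    exact hup' Δt u _ _ hΔt
  · obtain ⟨C, hC, hcons⟩ := ADER.exists_consistency hτ hτI hξI hexact hF hT hα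
      (hreg.of_le (by exact_mod_cast (by omega : M + 1 ≤ M + 2)))
    -- As β Δt ≤ 1/2, absorbing the contraction term costs a factor 2.
    refine ⟨2 * C, fun t Δt b ht hΔt htT hβΔ hb => ?_⟩
    rw [ADER.L2_eq_zero_iff] at hb
    set e : Fin (M + 1) → E := fun m => α (t + τ m * Δt) with he
    have h1 : ‖b - e‖ ≤ β * Δt * ‖b - e‖ + C * Δt ^ (M + 1) := by
      calc ‖b - e‖ = ‖(ADER.update τ ξ w F Δt (α t) b - ADER.update τ ξ w F Δt (α t) e)
            + (ADER.update τ ξ w F Δt (α t) e - e)‖ := by rw [sub_add_sub_cancel, ← hb]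
        _ ≤ _ := (norm_add_le _ _).trans
          (add_le_add (hup' Δt _ _ _ hΔt) (hcons t Δt ht hΔt htT).1)
    have h2 := mul_le_mul_of_nonneg_right hβΔ (norm_nonneg (b - e))
    linarith
  · obtain ⟨C₁, hC₁, hit⟩ := ADER.exists_iterate_error_le hτ hτI hξI hexact hF hT hα
      (hreg.of_le (by exact_mod_cast (by omega : M + 1 ≤ M + 2))) K
    obtain ⟨C₂, hC₂, hloc⟩ := ADER.exists_local_error_le hτ hτI hξI hexact hF hT hα hreg K
    obtain ⟨Λ, hΛ, hstab⟩ := ADER.exists_step_stability (ξ := ξ) (w := w) hτ hexact hF hT K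
    -- The nodal estimate has exponent `min (M + 1) (K + 1)`, at least the one claimed; any surplus
    -- power goes into the constant.
    set C₃ : ℝ := C₁ * (1 + T) ^ min (M + 1) (K + 1) with hC₃
    set C₄ : ℝ := Real.exp (Λ * T) * C₂ * T with hC₄
    have hC₃0 : 0 ≤ C₃ := by positivity
    have hC₄0 : 0 ≤ C₄ := by positivity
    refine ⟨C₃ + C₂ + C₄, fun t Δt a ht hΔt htT ha => ?_, fun t Δt v ht hΔt htT hv => ?_,
      fun N t u Δt hΔt ht0 htN hmesh hu0 hu n hn => ?_⟩
    · calc _ ≤ C₁ * Δt ^ min (M + 1) (K + 1) := hit t Δt a ht hΔt htT ha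
        _ ≤ C₁ * ((1 + T) ^ min (M + 1) (K + 1) * Δt ^ min (M + 1) K) :=
          mul_le_mul_of_nonneg_left
            (ADER.pow_le_mul_pow_of_le hΔt.le (by linarith) (by omega)) hC₁
        _ = C₃ * Δt ^ min (M + 1) K := by rw [hC₃, mul_assoc]
        _ ≤ _ := by gcongr; linarith
    · refine (hloc t Δt v ht hΔt htT hv).trans ?_
      gcongr
      linarith
    · have htn : t n ≤ T := (ADER.mesh_mono (fun n hn => (hmesh n hn).1) hn le_rfl).trans htN
      have htn0 : 0 ≤ t n :=
        ht0 ▸ ADER.mesh_mono (fun n hn => (hmesh n hn).1) (Nat.zero_le n) hn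
      have h := ADER.norm_sub_le_of_local_error hΛ hC₂ hstab (fun h u => by
        obtain ⟨a, ha, -⟩ := ADER.existsUnique_isDeCIteration τ ξ w F h u
        exact ⟨_, a, ha, rfl⟩) hloc ht0 htN hmesh hu0 hu n hn
      refine h.trans ?_
      calc _ ≤ Real.exp (Λ * T) * (C₂ * Δt ^ min (M + 1) K) * T := by gcongr
        _ = C₄ * Δt ^ min (M + 1) K := by rw [hC₄]; ring
        _ ≤ _ := by gcongr; linarith
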